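/- Let $\Omega\subset\mathbb R^d$ be a convex (Borel) set and $1\le p\le\infty$. Let $\mathcal W_p(\Omega)$ be the set of probability measures $\mu$ on $\Omega$ with $\int|x|^p\,d\mu<\infty$ (with bounded support, if $p=\infty$). For probability measures $\mu,\nu$ on $\Omega$ let $\Pi(\mu,\nu)$ be the set of transport plans, i.e. of probability measures $\gamma$ on $\Omega\times\Omega$ with first marginal $\mu$ and second marginal $\nu$. Equip $\mathcal W_p(\Omega)$ with the Wasserstein distance $$W_p(\mu,\nu)=\Big(\inf_{\gamma\in\Pi(\mu,\nu)}\int|x-y|^p\,d\gamma(x,y)\Big)^{1/p}\quad(p<\infty),\qquad W_\infty(\mu,\nu)=\inf_{\gamma\in\Pi(\mu,\nu)}\gamma\text{-}\operatorname{ess\,sup}|x-y| .$$ For $p<\infty$, an optimal transport plan from $\mu$ to $\nu$ is a $\gamma\in\Pi(\mu,\nu)$ that minimizes $\int|x-y|^p\,d\gamma$, and an optimal transport map from $\mu$ to $\nu$ is a measurable map $T$ such that $(\mathrm{id}\times T)_\#\mu$ is an optimal transport plan. A constant-speed geodesic from $\mu$ to $\nu$ is a curve $\omega:[0,1]\to\mathcal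 W_p(\Omega)$ with $\omega(0)=\mu$, $\omega(1)=\nu$ and $W_p(\omega(s),\omega(t))=|s-t|\,W_p(\mu,\nu)$ for all $s,t\in[0,1]$. For $s\in[0,1]$ put $p_s(x,y)=x+s(y-x)$. 1. $\mathcal W_p(\Omega)$ is a length space: the distance of any two of its points is the infimum of the lengths of the continuous curves that join them. Let now $p<\infty$ and $\mu,\nu\in\mathcal W_p(\Omega)$. 2. There is an optimal transport plan from $\mu$ to $\nu$, and for every such plan $\gamma$ the curve $s\mapsto(p_s)_\#\gamma$ takes its values in $\mathcal W_p(\Omega)$ and is a constant-speed geodesic from $\mu$ to $\nu$. 3. If $p>1$, then every constant-speed geodesic from $\mu$ to $\nu$ is of the form $s\mapsto(p_s)_\#\gamma$ for some optimal transport plan $\gamma$ from $\mu$ to $\nu$. 4. If $p>1$ and $\mu$ is absolutely continuous with respect to the Lebesgue measure, then there is an optimal transport map $T:\Omega\to\Omega$ from $\mu$ to $\nu$, unique up to $\mu$-a.e. equality, and there is exactly one constant-speed geodesic from $\mu$ to $\nu$, namely $s\mapsto[(1-s)\,\mathrm{id}+s\,T]_\#\mu$. -/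

import Mathlib

open MeasureTheory Set Filter Topology
open scoped ENNReal unitInterval

noncomputable section

namespace OptimalTransport

/-- The transport plans `Π(μ, ν)`: the probability measures on the product space whose two
marginals (push-forwards under the two projections) are `μ` and `ν`. -/
def transportPlans {X : Type*} [MeasurableSpace X] (μ ν : Measure X) : Set (Measure (X × X)) :=
  {γ | IsProbabilityMeasure γ ∧ γ.map Prod.fst = μ ∧ γ.map Prod.snd = ν}

/-- `γ` is an optimal transport plan from `μ` to `ν` for the cost `c`: it minimizes `∫ c dγ'` among
all the plans `γ' ∈ Π(μ, ν)`. -/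
def IsOptimalPlan {X : Type*} [MeasurableSpace X] (c : X → X → ℝ≥0∞) (μ ν : Measure X)
    (γ : Measure (X × X)) : Prop :=
  γ ∈ transportPlans μ ν ∧
    ∀ γ' ∈ transportPlans μ ν, ∫⁻ z, c z.1 z.2 ∂γ ≤ ∫⁻ z, c z.1 z.2 ∂γ'

/-- `T` is an optimal transport map from `μ` to `ν` for the cost `c`: it is measurable and
`(id × T)_# μ` is an optimal transport plan. -/
def IsOptimalMap {X : Type*} [MeasurableSpace X] (c : X → X → ℝ≥0∞) (μ ν : Measure X)
    (T : X → X) : Prop :=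
  Measurable T ∧ IsOptimalPlan c μ ν (μ.map fun x => (x, T x))

/-- The cost `c_p(x, y) = |x - y| ^ p` on `ℝᵈ`, for finite `p`. -/
def powCost {d : ℕ} (p : ℝ≥0∞) (x y : EuclideanSpace ℝ (Fin d)) : ℝ≥0∞ :=
  ‖x - y‖ₑ ^ p.toReal

/-- The Wasserstein distance `W_p(μ, ν)`, `1 ≤ p ≤ ∞`: the infimum, over the transport plans `γ`,
of the norm of `(x, y) ↦ |x - y|` in `L^p(γ)`. For `p < ∞` this is the `p`-th root of the least
value of `∫ |x - y| ^ p dγ` (see `wassersteinDist_eq`); for `p = ∞` the norm is the `γ`-essential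
supremum of `|x - y|`. -/
def wassersteinDist {d : ℕ} (p : ℝ≥0∞) (μ ν : Measure (EuclideanSpace ℝ (Fin d))) : ℝ≥0∞ :=
  ⨅ γ ∈ transportPlans μ ν, eLpNorm (fun z => z.1 - z.2) p γ

theorem wassersteinDist_eq {d : ℕ} {p : ℝ≥0∞} (hp : 1 ≤ p) (hp' : p ≠ ∞)
    (μ ν : Measure (EuclideanSpace ℝ (Fin d))) :
    wassersteinDist p μ ν =
      (⨅ γ ∈ transportPlans μ ν, ∫⁻ z, powCost p z.1 z.2 ∂γ) ^ (1 / p.toReal) := by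
  have hp0 : p ≠ 0 := (zero_lt_one.trans_le hp).ne'
  have h : 0 < 1 / p.toReal := one_div_pos.2 (ENNReal.toReal_pos hp0 hp')
  have key : ∀ a : ℝ≥0∞, a ^ (1 / p.toReal) = ENNReal.orderIsoRpow _ h a := fun _ => rfl
  simp only [wassersteinDist, eLpNorm_eq_lintegral_rpow_enorm_toReal hp0 hp', key,
    OrderIso.map_iInf, powCost]

/-- The set `𝒲_p(Ω)`, `1 ≤ p ≤ ∞`, of the probability measures on `Ω` with finite `p`-th moment
`∫ |x| ^ p dμ` (with bounded support, i.e. `|x|` essentially bounded, if `p = ∞`).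
A probability measure on `Ω` is seen as a probability measure on `ℝᵈ` concentrated on `Ω`; a
transport plan between two such measures is then concentrated on `Ω × Ω`. -/
@[ext]
structure WassersteinSpace {d : ℕ} (p : ℝ≥0∞) (Ω : Set (EuclideanSpace ℝ (Fin d))) where
  toMeasure : Measure (EuclideanSpace ℝ (Fin d))
  isProbabilityMeasure : IsProbabilityMeasure toMeasure
  concentrated : toMeasure Ωᶜ = 0
  finite_moment : MemLp (fun x => x) p toMeasure

attribute [instance] WassersteinSpace.isProbabilityMeasure

section Metric

variable {d : ℕ} {p : ℝ≥0∞} {μ ν ρ : Measure (EuclideanSpace ℝ (Fin d))}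

theorem wassersteinDist_self (μ : Measure (EuclideanSpace ℝ (Fin d))) [IsProbabilityMeasure μ] :
    wassersteinDist p μ μ = 0 := by
  have hm : Measurable fun x : EuclideanSpace ℝ (Fin d) => (x, x) := by fun_prop
  have h : μ.map (fun x => (x, x)) ∈ transportPlans μ μ := by
    refine ⟨Measure.isProbabilityMeasure_map hm.aemeasurable, ?_, ?_⟩
    · rw [Measure.map_map measurable_fst hm]; exact Measure.map_id
    · rw [Measure.map_map measurable_snd hm]; exact Measure.map_id
  refine le_antisymm ((iInf₂_le _ h).trans ?_) bot_le
  rw [eLpNorm_map_measure (by fun_prop) hm.aemeasurable]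
  simp [Function.comp_def]

theorem wassersteinDist_le_symm (μ ν : Measure (EuclideanSpace ℝ (Fin d))) :
    wassersteinDist p μ ν ≤ wassersteinDist p ν μ := by
  refine le_iInf₂ fun γ hγ => ?_
  obtain ⟨h0, h1, h2⟩ := hγ
  have h : γ.map Prod.swap ∈ transportPlans μ ν := by
    refine ⟨Measure.isProbabilityMeasure_map measurable_swap.aemeasurable, ?_, ?_⟩
    · rw [Measure.map_map measurable_fst measurable_swap, ← h2]; rfl
    · rw [Measure.map_map measurable_snd measurable_swap, ← h1]; rfl
  refine (iInf₂_le _ h).trans ?_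
  rw [eLpNorm_map_measure (by fun_prop) measurable_swap.aemeasurable, ← eLpNorm_neg]
  refine le_of_eq (congrArg (fun f => eLpNorm f p γ) ?_)
  ext z : 1
  simp [Function.comp_def]

theorem wassersteinDist_triangle (hp : 1 ≤ p) (μ ν ρ : Measure (EuclideanSpace ℝ (Fin d))) :
    wassersteinDist p μ ρ ≤ wassersteinDist p μ ν + wassersteinDist p ν ρ := by
  unfold wassersteinDist
  simp only [ENNReal.iInf_add, ENNReal.add_iInf]
  refine le_iInf₂ fun η hη => le_iInf₂ fun γ hγ => ?_
  obtain ⟨h0, h1, h2⟩ := hγ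
  obtain ⟨k0, k1, k2⟩ := hη
  let κ : ProbabilityTheory.Kernel (EuclideanSpace ℝ (Fin d) × EuclideanSpace ℝ (Fin d))
    (EuclideanSpace ℝ (Fin d)) := η.condKernel.comap Prod.snd measurable_snd
  let π := γ.compProd κ
  have hπ1 : π.map Prod.fst = γ := Measure.fst_compProd γ κ
  have hm : Measurable fun w : (EuclideanSpace ℝ (Fin d) × EuclideanSpace ℝ (Fin d)) ×
    EuclideanSpace ℝ (Fin d) => (w.1.2, w.2) := by fun_prop
  have hπ2 : π.map (fun w => (w.1.2, w.2)) = η := by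
    have hη : η = (γ.map Prod.snd).compProd η.condKernel := by
      rw [h2, ← k1]; exact (η.disintegrate η.condKernel).symm
    ext s hs
    rw [Measure.map_apply hm hs, Measure.compProd_apply (hm hs)]
    conv_rhs => rw [hη, Measure.compProd_apply hs,
      lintegral_map (ProbabilityTheory.Kernel.measurable_kernel_prodMk_left hs) measurable_snd]
    rfl
  have hm' : Measurable fun w : (EuclideanSpace ℝ (Fin d) × EuclideanSpace ℝ (Fin d)) ×
    EuclideanSpace ℝ (Fin d) => (w.1.1, w.2) := by fun_prop
  have h : π.map (fun w => (w.1.1, w.2)) ∈ transportPlans μ ρ := by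
    refine ⟨Measure.isProbabilityMeasure_map hm'.aemeasurable, ?_, ?_⟩
    · rw [Measure.map_map measurable_fst hm', ← h1, ← hπ1,
        Measure.map_map measurable_fst measurable_fst]
      rfl
    · rw [Measure.map_map measurable_snd hm', ← k2, ← hπ2, Measure.map_map measurable_snd hm]
      rfl
  refine (iInf₂_le _ h).trans ?_
  conv_rhs => rw [← hπ1, ← hπ2]
  rw [eLpNorm_map_measure (by fun_prop) hm'.aemeasurable,
    eLpNorm_map_measure (by fun_prop) hm.aemeasurable,
    eLpNorm_map_measure (by fun_prop) measurable_fst.aemeasurable]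
  refine le_trans (le_of_eq (congrArg (fun f => eLpNorm f p π) ?_))
    (eLpNorm_add_le (by fun_prop) (by fun_prop) hp)
  ext w : 1
  simp [Function.comp_def]

theorem measure_le_of_wassersteinDist_eq_zero (hp : 1 ≤ p) [IsProbabilityMeasure ν]
    (h : wassersteinDist p μ ν = 0) {F : Set (EuclideanSpace ℝ (Fin d))} (hF : IsClosed F) :
    μ F ≤ ν F := by
  have key : ∀ δ : ℝ, 0 < δ → μ F ≤ ν (Metric.cthickening δ F) := by
    intro δ hδ
    refine le_of_forall_pos_le_add fun ε hε => ?_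
    have hδ' : ENNReal.ofReal δ ≠ 0 := by simpa using hδ
    have hpos : wassersteinDist p μ ν < ε * ENNReal.ofReal δ := by
      rw [h]; exact pos_iff_ne_zero.2 (mul_ne_zero hε.ne' hδ')
    simp only [wassersteinDist, iInf_lt_iff] at hpos
    obtain ⟨γ, ⟨h0, h1, h2⟩, hγ⟩ := hpos
    have hL : ∫⁻ z, ‖z.1 - z.2‖ₑ ∂γ ≤ ε * ENNReal.ofReal δ := by
      rw [← eLpNorm_one_eq_lintegral_enorm]
      exact (eLpNorm_le_eLpNorm_of_exponent_le hp (by fun_prop)).trans hγ.le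
    have hM : γ {z | ENNReal.ofReal δ ≤ ‖z.1 - z.2‖ₑ} ≤ ε := by
      refine (meas_ge_le_lintegral_div (by fun_prop) hδ' ENNReal.ofReal_ne_top).trans ?_
      exact ENNReal.div_le_of_le_mul hL
    have hC : MeasurableSet (Metric.cthickening δ F) := Metric.isClosed_cthickening.measurableSet
    rw [← h1, ← h2, Measure.map_apply measurable_fst hF.measurableSet,
      Measure.map_apply measurable_snd hC]
    refine le_trans (measure_mono ?_) ((measure_union_le _ _).trans (add_le_add le_rfl hM))
    intro z hz
    by_cases hd : ENNReal.ofReal δ ≤ ‖z.1 - z.2‖ₑ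
    · exact Or.inr hd
    · refine Or.inl (Metric.mem_cthickening_of_edist_le z.2 z.1 δ F hz ?_)
      rw [edist_comm, edist_eq_enorm_sub]
      exact (not_le.1 hd).le
  have hlim : Tendsto (fun δ => ν (Metric.cthickening δ F)) (𝓝[>] (0 : ℝ)) (𝓝 (ν F)) :=
    (tendsto_measure_cthickening_of_isClosed
      ⟨1, one_pos, measure_ne_top _ _⟩ hF).mono_left nhdsWithin_le_nhds
  refine ge_of_tendsto hlim ?_
  filter_upwards [self_mem_nhdsWithin] with δ hδ using key δ hδ

theorem eq_of_wassersteinDist_eq_zero (hp : 1 ≤ p) [IsProbabilityMeasure μ]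
    [IsProbabilityMeasure ν] (h : wassersteinDist p μ ν = 0) : μ = ν := by
  have h' : wassersteinDist p ν μ = 0 := le_antisymm (h ▸ wassersteinDist_le_symm ν μ) bot_le
  refine ext_of_generate_finite {F | IsClosed F} ?_ isPiSystem_isClosed (fun F hF => ?_) (by simp)
  · rw [← borel_eq_generateFrom_isClosed]; exact BorelSpace.measurable_eq
  · exact le_antisymm (measure_le_of_wassersteinDist_eq_zero hp h hF)
      (measure_le_of_wassersteinDist_eq_zero hp h' hF)

theorem wassersteinDist_ne_top [IsProbabilityMeasure μ] [IsProbabilityMeasure ν]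
    (hμ : MemLp (fun x => x) p μ) (hν : MemLp (fun x => x) p ν) :
    wassersteinDist p μ ν ≠ ∞ := by
  have h : μ.prod ν ∈ transportPlans μ ν := by
    refine ⟨inferInstance, ?_, ?_⟩
    · exact Measure.fst_prod
    · exact Measure.snd_prod
  refine ((iInf₂_le _ h).trans_lt ?_).ne
  exact ((hμ.comp_measurePreserving measurePreserving_fst).sub
    (hν.comp_measurePreserving measurePreserving_snd)).eLpNorm_lt_top

/-- The metric space `𝒲_p(Ω)` (`1 ≤ p ≤ ∞`), with the distance `W_p`. -/
instance {Ω : Set (EuclideanSpace ℝ (Fin d))} [hp : Fact (1 ≤ p)] :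
    MetricSpace (WassersteinSpace p Ω) :=
  letI : EMetricSpace (WassersteinSpace p Ω) :=
    { edist := fun μ ν => wassersteinDist p μ.toMeasure ν.toMeasure
      edist_self := fun μ => wassersteinDist_self μ.toMeasure
      edist_comm := fun μ ν =>
        le_antisymm (wassersteinDist_le_symm _ _) (wassersteinDist_le_symm _ _)
      edist_triangle := fun μ ν ρ => wassersteinDist_triangle hp.out _ _ _
      eq_of_edist_eq_zero := fun {_ _} h =>
        WassersteinSpace.ext (eq_of_wassersteinDist_eq_zero hp.out h) }
  EMetricSpace.toMetricSpace fun μ ν => wassersteinDist_ne_top μ.finite_moment ν.finite_moment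

theorem WassersteinSpace.dist_eq {Ω : Set (EuclideanSpace ℝ (Fin d))} [Fact (1 ≤ p)]
    (μ ν : WassersteinSpace p Ω) :
    dist μ ν = (wassersteinDist p μ.toMeasure ν.toMeasure).toReal := rfl

end Metric

/-- A metric space is a length space if the distance of any two points is the infimum of the
lengths of the continuous curves joining them. -/
def IsLengthSpace (X : Type*) [MetricSpace X] : Prop :=
  ∀ x y : X, IsGLB {L : ℝ≥0∞ | ∃ ω : I → X, Continuous ω ∧ ω 0 = x ∧ ω 1 = y ∧
    L = eVariationOn ω univ} (edist x y)

/-- The curve `ω : [0, 1] → X` is a constant-speed geodesic from `x` to `y`. -/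
def IsConstantSpeedGeodesic {X : Type*} [MetricSpace X] (x y : X) (ω : I → X) : Prop :=
  ω 0 = x ∧ ω 1 = y ∧ ∀ s t : I, dist (ω s) (ω t) = |(s : ℝ) - t| * dist x y

/-- The map `p_s(x, y) = x + s (y - x)`. -/
def interpolation {d : ℕ} (s : ℝ) (z : EuclideanSpace ℝ (Fin d) × EuclideanSpace ℝ (Fin d)) :
    EuclideanSpace ℝ (Fin d) :=
  z.1 + s • (z.2 - z.1)

end OptimalTransport

end

open OptimalTransport

noncomputable section

namespace OptimalTransport

/-! Moving mass along straight segments turns any plan `γ` into a curve in `𝒲_p(Ω)` that is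
Lipschitz with constant the `L^p(γ)` norm of `x - y`. Taking the infimum over `γ` gives the
length-space property for every `p`, including `∞`. If `γ` is optimal, the triangle inequality
forces these Lipschitz bounds to be equalities. Optimal plans exist by Prokhorov's theorem and lower
semicontinuity of the cost.

For `1 < p < ∞`, strict convexity of `|x|^p` settles the equality case of Minkowski's inequality
(`ae_eq_of_le_eLpNorm_combo`). When optimal plans along a geodesic are glued, almost every triple is
therefore collinear, with the middle point at the prescribed ratio (`exists_plan_through`). So
optimal plans ending at, or starting from, an interior time are unique, and one plan from `μ` to
`ν`, built through the midpoint, generates the whole geodesic.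

For absolutely continuous `μ`, the support of an optimal plan is monotone for pairs of points:
exchanging two targets cannot lower the cost. A Lebesgue density argument
(`eq_of_monotone_of_density`) shows that almost every source point has at most one partner in such a
set, so every optimal plan is carried by a graph. Averaging two optimal plans shows that their
graphs agree, hence the plan is unique, and with it the geodesic. Neither dual potentials nor their
differentiability enter. -/

/-- Two transport plans with a common marginal can be glued. -/
theorem exists_gluing {X : Type*} [MeasurableSpace X] [StandardBorelSpace X] [Nonempty X]
    {μ ν ρ : Measure X} {γ η : Measure (X × X)} (hγ : γ ∈ transportPlans μ ν)
    (hη : η ∈ transportPlans ν ρ) :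
    ∃ π : Measure ((X × X) × X), IsProbabilityMeasure π ∧ π.map Prod.fst = γ ∧
      π.map (fun w => (w.1.2, w.2)) = η := by
  obtain ⟨h0, h1, h2⟩ := hγ
  obtain ⟨k0, k1, k2⟩ := hη
  let κ : ProbabilityTheory.Kernel (X × X) X := η.condKernel.comap Prod.snd measurable_snd
  have hm : Measurable fun w : (X × X) × X => (w.1.2, w.2) := by fun_prop
  refine ⟨γ.compProd κ, inferInstance, Measure.fst_compProd γ κ, ?_⟩
  have hη : η = (γ.map Prod.snd).compProd η.condKernel := by
    rw [h2, ← k1]; exact (η.disintegrate η.condKernel).symm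
  ext s hs
  rw [Measure.map_apply hm hs, Measure.compProd_apply (hm hs)]
  conv_rhs => rw [hη, Measure.compProd_apply hs,
    lintegral_map (ProbabilityTheory.Kernel.measurable_kernel_prodMk_left hs) measurable_snd]
  rfl

/-! ### Existence of optimal plans. -/

section Existence

variable {X : Type*} [MeasurableSpace X] [TopologicalSpace X] [BorelSpace X]

/-- By monotone convergence the integral is the supremum over `n` of the integrals of the
truncations `min f n`, each of which is weakly continuous. -/
theorem lowerSemicontinuous_lintegral {f : X → ℝ≥0∞} (hf : Continuous f) :
    LowerSemicontinuous fun γ : ProbabilityMeasure X => ∫⁻ z, f z ∂(γ : Measure X) := by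
  let g : ℕ → BoundedContinuousFunction X NNReal := fun n =>
    BoundedContinuousFunction.mkOfBound
      ⟨fun z => (min (f z) n).toNNReal, by
        refine ENNReal.continuousOn_toNNReal.comp_continuous (hf.min continuous_const) fun z => ?_
        exact ((min_le_right _ _).trans_lt (ENNReal.natCast_lt_top n)).ne⟩ n (fun x y => by
          have key : ∀ z, (min (f z) n).toNNReal ≤ (n : NNReal) := fun z => by
            have := ENNReal.toNNReal_mono (ENNReal.natCast_ne_top n) (min_le_right (f z) n)
            simpa using this
          rw [NNReal.dist_eq]
          have hx := NNReal.coe_le_coe.2 (key x)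
          have hy := NNReal.coe_le_coe.2 (key y)
          simp only [NNReal.coe_natCast] at hx hy
          exact abs_sub_le_of_nonneg_of_le (NNReal.coe_nonneg _) hx (NNReal.coe_nonneg _) hy)
  have hg : ∀ n z, ((g n z : NNReal) : ℝ≥0∞) = min (f z) n := fun n z =>
    ENNReal.coe_toNNReal ((min_le_right _ _).trans_lt (ENNReal.natCast_lt_top n)).ne
  have hsup : ∀ z, f z = ⨆ n : ℕ, ((g n z : NNReal) : ℝ≥0∞) := fun z => by
    simp_rw [hg]
    rw [← inf_iSup_eq, ENNReal.iSup_natCast, inf_top_eq]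
  have hmono : Monotone fun (n : ℕ) z => ((g n z : NNReal) : ℝ≥0∞) := fun m n h z => by
    simp only [hg]
    gcongr
  have h : (fun γ : ProbabilityMeasure X => ∫⁻ z, f z ∂(γ : Measure X)) =
      fun γ : ProbabilityMeasure X => ⨆ n, ∫⁻ z, ((g n z : NNReal) : ℝ≥0∞) ∂(γ : Measure X) := by
    funext γ
    rw [← lintegral_iSup (fun n => by fun_prop) hmono]
    exact lintegral_congr hsup
  rw [h]
  exact lowerSemicontinuous_iSup fun n =>
    (ProbabilityMeasure.continuous_lintegral_boundedContinuousFunction (g n)).lowerSemicontinuous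

/-- The plans form a weakly compact set: closed because push-forward to the marginals is continuous,
tight because each marginal is. A lower semicontinuous cost attains its minimum there. -/
theorem exists_isOptimalPlan {X : Type*} [MeasurableSpace X] [PseudoEMetricSpace X] [T2Space X]
    [CompleteSpace X] [SecondCountableTopology X] [BorelSpace X]
    {c : X → X → ℝ≥0∞} (hc : Continuous fun z : X × X => c z.1 z.2) (μ ν : Measure X)
    [IsProbabilityMeasure μ] [IsProbabilityMeasure ν] : ∃ γ, IsOptimalPlan c μ ν γ := by
  let S : Set (ProbabilityMeasure (X × X)) := {γ | (γ : Measure (X × X)) ∈ transportPlans μ ν}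
  have hS : S = (fun γ => γ.map (f := Prod.fst) measurable_fst.aemeasurable) ⁻¹'
      {(⟨μ, inferInstance⟩ : ProbabilityMeasure X)} ∩
      (fun γ => γ.map (f := Prod.snd) measurable_snd.aemeasurable) ⁻¹'
      {(⟨ν, inferInstance⟩ : ProbabilityMeasure X)} := by
    ext γ
    exact ⟨fun h => ⟨Subtype.ext h.2.1, Subtype.ext h.2.2⟩,
      fun h => ⟨inferInstance, congrArg Subtype.val h.1, congrArg Subtype.val h.2⟩⟩
  have hclosed : IsClosed S := by
    rw [hS]
    exact (isClosed_singleton.preimage (ProbabilityMeasure.continuous_map continuous_fst)).inter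
      (isClosed_singleton.preimage (ProbabilityMeasure.continuous_map continuous_snd))
  have htight : IsTightMeasureSet {((γ : ProbabilityMeasure (X × X)) : Measure (X × X)) | γ ∈ S} := by
    refine IsTightMeasureSet.prodMk ?_ ?_
    · refine (isTightMeasureSet_singleton (μ := μ)).subset ?_
      rintro _ ⟨_, ⟨γ, hγ, rfl⟩, rfl⟩
      exact hγ.2.1
    · refine (isTightMeasureSet_singleton (μ := ν)).subset ?_
      rintro _ ⟨_, ⟨γ, hγ, rfl⟩, rfl⟩
      exact hγ.2.2
  have hcomp : IsCompact S := by
    rw [← hclosed.closure_eq]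
    exact isCompact_closure_of_isTightMeasureSet htight
  have hne : S.Nonempty := ⟨⟨μ.prod ν, inferInstance⟩,
    (inferInstance : IsProbabilityMeasure (μ.prod ν)), Measure.fst_prod, Measure.snd_prod⟩
  obtain ⟨γ, hγ, hmin⟩ :=
    ((lowerSemicontinuous_lintegral hc).lowerSemicontinuousOn S).exists_isMinOn hne hcomp
  exact ⟨γ, hγ, fun γ' hγ' => hmin (a := ⟨γ', hγ'.1⟩) hγ'⟩

end Existence

/-! ### Displacement interpolation: length space and geodesics from plans. -/

section Geodesics

variable {d : ℕ} {p : ℝ≥0∞} {Ω : Set (EuclideanSpace ℝ (Fin d))}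
  {μ ν : Measure (EuclideanSpace ℝ (Fin d))}
  {γ : Measure (EuclideanSpace ℝ (Fin d) × EuclideanSpace ℝ (Fin d))}

theorem continuous_powCost (p : ℝ≥0∞) :
    Continuous fun z : EuclideanSpace ℝ (Fin d) × EuclideanSpace ℝ (Fin d) =>
      powCost p z.1 z.2 :=
  (ENNReal.continuous_rpow_const).comp (continuous_fst.sub continuous_snd).enorm

theorem lintegral_powCost (hp : 1 ≤ p) (hp' : p ≠ ∞)
    (γ : Measure (EuclideanSpace ℝ (Fin d) × EuclideanSpace ℝ (Fin d))) :
    ∫⁻ z, powCost p z.1 z.2 ∂γ = eLpNorm (fun z => z.1 - z.2) p γ ^ p.toReal := by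
  have hp0 : p ≠ 0 := (zero_lt_one.trans_le hp).ne'
  rw [eLpNorm_eq_lintegral_rpow_enorm_toReal hp0 hp', ← ENNReal.rpow_mul,
    one_div_mul_cancel (ENNReal.toReal_pos hp0 hp').ne', ENNReal.rpow_one]
  rfl

theorem isOptimalPlan_iff (hp : 1 ≤ p) (hp' : p ≠ ∞) :
    IsOptimalPlan (powCost p) μ ν γ ↔
      γ ∈ transportPlans μ ν ∧ eLpNorm (fun z => z.1 - z.2) p γ ≤ wassersteinDist p μ ν := by
  have h : 0 < p.toReal := ENNReal.toReal_pos (zero_lt_one.trans_le hp).ne' hp'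
  simp only [IsOptimalPlan, lintegral_powCost hp hp', ENNReal.rpow_le_rpow_iff h, wassersteinDist,
    le_iInf_iff]

theorem wassersteinDist_le (hγ : γ ∈ transportPlans μ ν) :
    wassersteinDist p μ ν ≤ eLpNorm (fun z => z.1 - z.2) p γ :=
  iInf₂_le _ hγ

theorem measurable_interpolation (s : ℝ) : Measurable (interpolation (d := d) s) := by
  unfold interpolation
  fun_prop

theorem interpolation_mem (hΩ : Convex ℝ Ω) {s : ℝ} (hs : s ∈ I)
    {z : EuclideanSpace ℝ (Fin d) × EuclideanSpace ℝ (Fin d)} (h1 : z.1 ∈ Ω) (h2 : z.2 ∈ Ω) :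
    interpolation s z ∈ Ω :=
  hΩ.add_smul_sub_mem h1 h2 hs

theorem map_interpolation_mem_transportPlans [IsProbabilityMeasure γ] (s t : ℝ) :
    γ.map (fun z => (interpolation s z, interpolation t z)) ∈
      transportPlans (γ.map (interpolation s)) (γ.map (interpolation t)) := by
  have hm := (measurable_interpolation (d := d) s).prodMk (measurable_interpolation t)
  refine ⟨Measure.isProbabilityMeasure_map hm.aemeasurable, ?_, ?_⟩
  · rw [Measure.map_map measurable_fst hm]; rfl
  · rw [Measure.map_map measurable_snd hm]; rfl

theorem eLpNorm_map_interpolation (s t : ℝ)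
    (γ : Measure (EuclideanSpace ℝ (Fin d) × EuclideanSpace ℝ (Fin d))) :
    eLpNorm (fun z => z.1 - z.2) p (γ.map fun z => (interpolation s z, interpolation t z)) =
      ‖s - t‖ₑ * eLpNorm (fun z => z.1 - z.2) p γ := by
  have hm := (measurable_interpolation (d := d) s).prodMk (measurable_interpolation t)
  rw [eLpNorm_map_measure (by fun_prop) hm.aemeasurable, ← enorm_neg (s - t),
    ← eLpNorm_const_smul]
  congr 1
  ext z : 1
  simp only [Function.comp_def, interpolation, Pi.smul_apply]
  module

theorem wassersteinDist_map_interpolation_le [IsProbabilityMeasure γ] (s t : ℝ) :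
    wassersteinDist p (γ.map (interpolation s)) (γ.map (interpolation t)) ≤
      ‖s - t‖ₑ * eLpNorm (fun z => z.1 - z.2) p γ :=
  (wassersteinDist_le (map_interpolation_mem_transportPlans s t)).trans_eq
    (eLpNorm_map_interpolation s t γ)

theorem memLp_fst_of_mem_transportPlans (hγ : γ ∈ transportPlans μ ν)
    (hμ : MemLp (fun x => x) p μ) : MemLp (fun z => z.1) p γ :=
  hμ.comp_measurePreserving ⟨measurable_fst, hγ.2.1⟩

theorem memLp_snd_of_mem_transportPlans (hγ : γ ∈ transportPlans μ ν)
    (hν : MemLp (fun x => x) p ν) : MemLp (fun z => z.2) p γ :=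
  hν.comp_measurePreserving ⟨measurable_snd, hγ.2.2⟩

theorem ae_fst_mem_of_mem_transportPlans (hγ : γ ∈ transportPlans μ ν) (hμ : μ Ωᶜ = 0) :
    ∀ᵐ z ∂γ, z.1 ∈ Ω :=
  ae_of_ae_map measurable_fst.aemeasurable (p := fun x => x ∈ Ω) (by rw [hγ.2.1]; exact hμ)

theorem ae_snd_mem_of_mem_transportPlans (hγ : γ ∈ transportPlans μ ν) (hν : ν Ωᶜ = 0) :
    ∀ᵐ z ∂γ, z.2 ∈ Ω :=
  ae_of_ae_map measurable_snd.aemeasurable (p := fun x => x ∈ Ω) (by rw [hγ.2.2]; exact hν)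

/-- The curve `s ↦ (p_s)_# γ` in `𝒲_p(Ω)`. -/
def interpolationCurve (hΩ : Convex ℝ Ω) (hΩm : MeasurableSet Ω) {μ ν : WassersteinSpace p Ω}
    (hγ : γ ∈ transportPlans μ.toMeasure ν.toMeasure) (s : I) : WassersteinSpace p Ω where
  toMeasure := γ.map (interpolation s)
  isProbabilityMeasure :=
    haveI := hγ.1
    Measure.isProbabilityMeasure_map (measurable_interpolation _).aemeasurable
  concentrated := by
    rw [Measure.map_apply (measurable_interpolation _) hΩm.compl]
    change ∀ᵐ z ∂γ, interpolation (s : ℝ) z ∈ Ω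
    filter_upwards [ae_fst_mem_of_mem_transportPlans hγ μ.concentrated,
      ae_snd_mem_of_mem_transportPlans hγ ν.concentrated] with z h1 h2
    exact interpolation_mem hΩ s.2 h1 h2
  finite_moment := by
    have h1 := memLp_fst_of_mem_transportPlans hγ μ.finite_moment
    have h2 := memLp_snd_of_mem_transportPlans hγ ν.finite_moment
    rw [memLp_map_measure_iff (by fun_prop) (measurable_interpolation _).aemeasurable]
    exact h1.add ((h2.sub h1).const_smul (s : ℝ))

variable {μ ν : WassersteinSpace p Ω}

theorem interpolationCurve_zero (hΩ : Convex ℝ Ω) (hΩm : MeasurableSet Ω)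
    (hγ : γ ∈ transportPlans μ.toMeasure ν.toMeasure) :
    interpolationCurve hΩ hΩm hγ 0 = μ := by
  refine WassersteinSpace.ext (Eq.trans ?_ hγ.2.1)
  simp only [interpolationCurve]
  congr 1
  ext z : 1
  simp [interpolation]

theorem interpolationCurve_one (hΩ : Convex ℝ Ω) (hΩm : MeasurableSet Ω)
    (hγ : γ ∈ transportPlans μ.toMeasure ν.toMeasure) :
    interpolationCurve hΩ hΩm hγ 1 = ν := by
  refine WassersteinSpace.ext (Eq.trans ?_ hγ.2.2)
  simp only [interpolationCurve]
  congr 1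
  ext z : 1
  simp [interpolation]

theorem eLpNorm_ne_top_of_mem_transportPlans
    (hγ : γ ∈ transportPlans μ.toMeasure ν.toMeasure) :
    eLpNorm (fun z => z.1 - z.2) p γ ≠ ∞ :=
  ((memLp_fst_of_mem_transportPlans hγ μ.finite_moment).sub
    (memLp_snd_of_mem_transportPlans hγ ν.finite_moment)).eLpNorm_lt_top.ne

variable [Fact (1 ≤ p)]

theorem WassersteinSpace.edist_eq (μ ν : WassersteinSpace p Ω) :
    edist μ ν = wassersteinDist p μ.toMeasure ν.toMeasure := rfl

theorem edist_interpolationCurve_le (hΩ : Convex ℝ Ω) (hΩm : MeasurableSet Ω)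
    (hγ : γ ∈ transportPlans μ.toMeasure ν.toMeasure) (s t : I) :
    edist (interpolationCurve hΩ hΩm hγ s) (interpolationCurve hΩ hΩm hγ t) ≤
      eLpNorm (fun z => z.1 - z.2) p γ * edist s t := by
  have := hγ.1
  rw [mul_comm, Subtype.edist_eq, edist_eq_enorm_sub]
  exact wassersteinDist_map_interpolation_le _ _

theorem eVariationOn_unitInterval_coe_le : eVariationOn (fun s : I => s) univ ≤ 1 := by
  have h : MonotoneOn ((↑) : I → ℝ) univ := fun _ _ _ _ h => h
  have := h.eVariationOn_eq (mem_univ 0) (mem_univ 1)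
  have hI : (univ ∩ Icc 0 1 : Set I) = univ := by
    rw [univ_inter]
    exact eq_univ_of_forall fun x => ⟨x.2.1, x.2.2⟩
  rw [hI] at this
  simp only [Icc.coe_one, Icc.coe_zero, sub_zero, ENNReal.ofReal_one] at this
  exact this.le

/-- No optimal plan is needed, so `p = ∞` is covered: the curve of an arbitrary plan has length at
most the cost of that plan, and the distance is the infimum of these costs. -/
theorem isLengthSpace_wassersteinSpace (hΩ : Convex ℝ Ω) (hΩm : MeasurableSet Ω) :
    IsLengthSpace (WassersteinSpace p Ω) := by
  refine fun μ ν => ⟨?_, fun b hb => ?_⟩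
  · rintro _ ⟨ω, -, rfl, rfl, rfl⟩
    exact eVariationOn.edist_le ω (mem_univ 0) (mem_univ 1)
  · refine le_iInf₂ fun γ hγ => ?_
    obtain ⟨C, hC⟩ : ∃ C : NNReal, (C : ℝ≥0∞) = eLpNorm (fun z => z.1 - z.2) p γ :=
      ⟨_, ENNReal.coe_toNNReal (eLpNorm_ne_top_of_mem_transportPlans hγ)⟩
    have hL : LipschitzWith C (interpolationCurve hΩ hΩm hγ) := fun s t => by
      rw [hC]
      exact edist_interpolationCurve_le hΩ hΩm hγ s t
    refine (hb ⟨_, hL.continuous, interpolationCurve_zero hΩ hΩm hγ,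
      interpolationCurve_one hΩ hΩm hγ, rfl⟩).trans ?_
    refine ((hL.lipschitzOnWith (s := univ)).comp_eVariationOn_le
      (f := interpolationCurve hΩ hΩm hγ) (g := fun s : I => s) (mapsTo_univ _ _)).trans ?_
    rw [← hC]
    exact mul_le_of_le_one_right' eVariationOn_unitInterval_coe_le

theorem isConstantSpeedGeodesic_interpolationCurve (hΩ : Convex ℝ Ω) (hΩm : MeasurableSet Ω)
    (hp : p ≠ ∞) (hγ : IsOptimalPlan (powCost p) μ.toMeasure ν.toMeasure γ) :
    IsConstantSpeedGeodesic μ ν (interpolationCurve hΩ hΩm hγ.1) := by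
  set ω := interpolationCurve hΩ hΩm hγ.1
  have h0 : ω 0 = μ := interpolationCurve_zero hΩ hΩm hγ.1
  have h1 : ω 1 = ν := interpolationCurve_one hΩ hΩm hγ.1
  have hle : ∀ s t : I, dist (ω s) (ω t) ≤ |(s : ℝ) - t| * dist μ ν := by
    intro s t
    have h := (edist_interpolationCurve_le hΩ hΩm hγ.1 s t).trans
      (mul_le_mul_left ((isOptimalPlan_iff Fact.out hp).1 hγ).2 _)
    rw [← WassersteinSpace.edist_eq, edist_dist, edist_dist, edist_dist,
      ← ENNReal.ofReal_mul dist_nonneg,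
      ENNReal.ofReal_le_ofReal_iff (mul_nonneg dist_nonneg dist_nonneg), mul_comm] at h
    exact h
  -- The upper bounds on `[0, s]` and `[t, 1]` leave at least `(t - s) * dist μ ν` for the middle
  -- piece.
  have hge : ∀ s t : I, s ≤ t → |(s : ℝ) - t| * dist μ ν ≤ dist (ω s) (ω t) := by
    intro s t hst
    have hst' : (s : ℝ) ≤ t := hst
    have a := hle 0 s
    have b := hle t 1
    have tri := dist_triangle4 (ω 0) (ω s) (ω t) (ω 1)
    rw [h0] at a tri
    rw [h1] at b tri
    simp only [Icc.coe_zero, Icc.coe_one] at a b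
    rw [zero_sub, abs_neg, abs_of_nonneg s.2.1] at a
    rw [abs_of_nonpos (by linarith [t.2.2])] at b
    rw [abs_of_nonpos (by linarith)]
    linarith
  refine ⟨h0, h1, fun s t => le_antisymm (hle s t) ?_⟩
  rcases le_total s t with h | h
  · exact hge s t h
  · rw [dist_comm (ω s), abs_sub_comm]
    exact hge t s h

end Geodesics

/-! ### Strict convexity and the equality case of Minkowski's inequality. -/

section StrictConvexity

variable {E : Type*} [NormedAddCommGroup E] [NormedSpace ℝ E] [StrictConvexSpace ℝ E]

/-- For vectors of equal norm the strictness comes from the unit ball; for different norms it comes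
from the real function `t ^ q`. -/
theorem strictConvexOn_norm_rpow {q : ℝ} (hq : 1 < q) :
    StrictConvexOn ℝ univ fun x : E => ‖x‖ ^ q := by
  refine ⟨convex_univ, fun x _ y _ hxy a b ha hb hab => ?_⟩
  have hq0 : 0 < q := by linarith
  simp only [smul_eq_mul]
  by_cases h : ‖x‖ = ‖y‖
  · have := norm_combo_lt_of_ne h.le le_rfl hxy ha hb hab
    rw [h, ← add_mul, hab, one_mul]
    exact Real.rpow_lt_rpow (norm_nonneg _) this hq0
  · have h1 : ‖a • x + b • y‖ ≤ a * ‖x‖ + b * ‖y‖ := by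
      refine (norm_add_le _ _).trans_eq ?_
      rw [norm_smul, norm_smul, Real.norm_of_nonneg ha.le, Real.norm_of_nonneg hb.le]
    exact (Real.rpow_le_rpow (norm_nonneg _) h1 hq0.le).trans_lt
      ((strictConvexOn_rpow hq).2 (norm_nonneg x) (norm_nonneg y) h ha hb hab)

/-- The convexity gap of `‖·‖ ^ p` between `u` and `v` is nonnegative, and the norm bounds make its
integral nonpositive. It vanishes almost everywhere, which strict convexity allows only where `u =
v`. -/
theorem ae_eq_of_le_eLpNorm_combo {α : Type*} [MeasurableSpace α] {π : Measure α} {p : ℝ≥0∞}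
    (hp : 1 < p) (hp' : p ≠ ∞) {u v : α → E} (hu : MemLp u p π) (hv : MemLp v p π)
    {a b : ℝ} (ha : 0 < a) (hb : 0 < b) (hab : a + b = 1) {D : ℝ≥0∞} (huD : eLpNorm u p π ≤ D)
    (hvD : eLpNorm v p π ≤ D) (hD : D ≤ eLpNorm (a • u + b • v) p π) : u =ᵐ[π] v := by
  have hp0 : p ≠ 0 := (zero_lt_one.trans hp).ne'
  have hq : 1 < p.toReal := by
    rwa [← ENNReal.toReal_one, ENNReal.toReal_lt_toReal ENNReal.one_ne_top hp']
  have hw : MemLp (a • u + b • v) p π := (hu.const_smul a).add (hv.const_smul b)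
  have hint : ∀ {f g : α → E}, MemLp f p π → MemLp g p π → eLpNorm f p π ≤ eLpNorm g p π →
      ∫ x, ‖f x‖ ^ p.toReal ∂π ≤ ∫ x, ‖g x‖ ^ p.toReal ∂π := by
    intro f g hf hg h
    rw [hf.eLpNorm_eq_integral_rpow_norm hp0 hp', hg.eLpNorm_eq_integral_rpow_norm hp0 hp',
      ENNReal.ofReal_le_ofReal_iff (by positivity),
      Real.rpow_le_rpow_iff (by positivity) (by positivity) (by positivity)] at h
    exact h
  have iu := hu.integrable_norm_rpow hp0 hp'
  have iv := hv.integrable_norm_rpow hp0 hp'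
  have iw := hw.integrable_norm_rpow hp0 hp'
  have hsc := strictConvexOn_norm_rpow (E := E) hq
  have hnn : 0 ≤ fun x => a * ‖u x‖ ^ p.toReal + b * ‖v x‖ ^ p.toReal -
      ‖(a • u + b • v) x‖ ^ p.toReal := fun x =>
    sub_nonneg.2 (hsc.convexOn.2 (mem_univ (u x)) (mem_univ (v x)) ha.le hb.le hab)
  have hI := integral_nonneg hnn (μ := π)
  have hzero : ∫ x, (a * ‖u x‖ ^ p.toReal + b * ‖v x‖ ^ p.toReal -
      ‖(a • u + b • v) x‖ ^ p.toReal) ∂π = 0 := by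
    refine le_antisymm ?_ hI
    rw [integral_sub (f := fun x => a * ‖u x‖ ^ p.toReal + b * ‖v x‖ ^ p.toReal)
        ((iu.const_mul a).add (iv.const_mul b)) iw, integral_add (iu.const_mul a) (iv.const_mul b),
      integral_const_mul, integral_const_mul]
    have h1 := hint hu hw (huD.trans hD)
    have h2 := hint hv hw (hvD.trans hD)
    have hb' : b = 1 - a := by linarith
    have := mul_le_mul_of_nonneg_left h1 ha.le
    have := mul_le_mul_of_nonneg_left h2 hb.le
    subst hb'
    linarith
  rw [integral_eq_zero_iff_of_nonneg hnn (((iu.const_mul a).add (iv.const_mul b)).sub iw)] at hzero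
  filter_upwards [hzero] with x hx
  by_contra hne
  have := hsc.2 (mem_univ (u x)) (mem_univ (v x)) hne ha hb hab
  simp only [smul_eq_mul] at this
  simp only [Pi.zero_apply, Pi.add_apply, Pi.smul_apply] at hx
  linarith

end StrictConvexity

/-! ### For `1 < p < ∞`, every geodesic comes from an optimal plan. -/

section Geodesics

variable {d : ℕ} {p : ℝ≥0∞} {Ω : Set (EuclideanSpace ℝ (Fin d))}

/-- A point `w` is a triple: start `w.1.1`, middle `w.1.2`, end `w.2`. Up to sign, `u` and `v` are
the velocities on the two legs. Both have norm at most `D` while their average `w.1.1 - w.2` has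
norm at least `D`, so they agree and the middle point lies on the segment at time `t`. -/
theorem ae_eq_interpolation {π : Measure ((EuclideanSpace ℝ (Fin d) × EuclideanSpace ℝ (Fin d)) ×
      EuclideanSpace ℝ (Fin d))} (hp : 1 < p) (hp' : p ≠ ∞) {t : ℝ} (ht : 0 < t) (ht' : t < 1)
    {D : ℝ≥0∞} (hD : D ≠ ∞)
    (h1 : eLpNorm (fun w => w.1.1 - w.1.2) p π ≤ ENNReal.ofReal t * D)
    (h2 : eLpNorm (fun w => w.1.2 - w.2) p π ≤ ENNReal.ofReal (1 - t) * D)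
    (h3 : D ≤ eLpNorm (fun w => w.1.1 - w.2) p π) :
    (∀ᵐ w ∂π, w.1.2 = interpolation t (w.1.1, w.2)) ∧
      eLpNorm (fun w => w.1.1 - w.2) p π ≤ D := by
  have ht1 : 0 < 1 - t := by linarith
  let u : (EuclideanSpace ℝ (Fin d) × EuclideanSpace ℝ (Fin d)) × EuclideanSpace ℝ (Fin d) →
    EuclideanSpace ℝ (Fin d) := t⁻¹ • fun w => w.1.1 - w.1.2
  let v : (EuclideanSpace ℝ (Fin d) × EuclideanSpace ℝ (Fin d)) × EuclideanSpace ℝ (Fin d) →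
    EuclideanSpace ℝ (Fin d) := (1 - t)⁻¹ • fun w => w.1.2 - w.2
  have key : ∀ {r : ℝ} {f : (EuclideanSpace ℝ (Fin d) × EuclideanSpace ℝ (Fin d)) ×
      EuclideanSpace ℝ (Fin d) → EuclideanSpace ℝ (Fin d)}, 0 < r →
      eLpNorm f p π ≤ ENNReal.ofReal r * D → eLpNorm (r⁻¹ • f) p π ≤ D := by
    intro r f hr h
    rw [eLpNorm_const_smul, enorm_inv hr.ne', Real.enorm_of_nonneg hr.le,
      ← ENNReal.div_eq_inv_mul]
    exact ENNReal.div_le_of_le_mul' h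
  have hu := key ht h1
  have hv := key ht1 h2
  have huv : (t • u + (1 - t) • v) = fun w => w.1.1 - w.2 := by
    simp only [u, v, smul_smul, mul_inv_cancel₀ ht.ne', mul_inv_cancel₀ ht1.ne', one_smul]
    ext w : 1
    simp
  have hae := ae_eq_of_le_eLpNorm_combo (u := u) (v := v) hp hp'
    ⟨by fun_prop, hu.trans_lt hD.lt_top⟩ ⟨by fun_prop, hv.trans_lt hD.lt_top⟩ ht ht1 (by ring)
    hu hv (by rwa [huv])
  constructor
  · filter_upwards [hae] with w hw
    simp only [u, v, Pi.smul_apply] at hw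
    have h := congrArg (fun x => (t * (1 - t)) • x) hw
    simp only [smul_smul] at h
    rw [show t * (1 - t) * t⁻¹ = 1 - t by field_simp,
      show t * (1 - t) * (1 - t)⁻¹ = t by field_simp] at h
    simp only [interpolation]
    have h' : w.1.2 - (w.1.1 + t • (w.2 - w.1.1)) =
        t • (w.1.2 - w.2) - (1 - t) • (w.1.1 - w.1.2) := by module
    rw [← sub_eq_zero, h', h, sub_self]
  · rw [← huv]
    refine le_trans (le_of_eq (eLpNorm_congr_ae ?_)) hu
    filter_upwards [hae] with w hw
    change t • u w + (1 - t) • v w = u w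
    rw [← hw]
    module

/-- In the gluing of `γ` and `η` the middle point is a function of the outer two, so forgetting it
loses nothing: both plans can be read off from `ζ`. -/
theorem exists_plan_through {μ ν ρ : Measure (EuclideanSpace ℝ (Fin d))}
    {γ η : Measure (EuclideanSpace ℝ (Fin d) × EuclideanSpace ℝ (Fin d))}
    (hp : 1 < p) (hp' : p ≠ ∞) {t : ℝ} (ht : 0 < t) (ht' : t < 1) {D : ℝ≥0∞} (hD : D ≠ ∞)
    (hγ : γ ∈ transportPlans μ ν) (hη : η ∈ transportPlans ν ρ)
    (h1 : eLpNorm (fun z => z.1 - z.2) p γ ≤ ENNReal.ofReal t * D)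
    (h2 : eLpNorm (fun z => z.1 - z.2) p η ≤ ENNReal.ofReal (1 - t) * D)
    (h3 : D ≤ wassersteinDist p μ ρ) :
    ∃ ζ ∈ transportPlans μ ρ, eLpNorm (fun z => z.1 - z.2) p ζ ≤ D ∧
      ζ.map (fun z => (z.1, interpolation t z)) = γ ∧
      ζ.map (fun z => (interpolation t z, z.2)) = η := by
  obtain ⟨π, hπ, hπ1, hπ2⟩ := exists_gluing hγ hη
  have hm : Measurable fun w : (EuclideanSpace ℝ (Fin d) × EuclideanSpace ℝ (Fin d)) ×
    EuclideanSpace ℝ (Fin d) => (w.1.2, w.2) := by fun_prop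
  have hm' : Measurable fun w : (EuclideanSpace ℝ (Fin d) × EuclideanSpace ℝ (Fin d)) ×
    EuclideanSpace ℝ (Fin d) => (w.1.1, w.2) := by fun_prop
  have hi := measurable_interpolation (d := d) t
  have hζ : π.map (fun w => (w.1.1, w.2)) ∈ transportPlans μ ρ := by
    refine ⟨Measure.isProbabilityMeasure_map hm'.aemeasurable, ?_, ?_⟩
    · rw [Measure.map_map measurable_fst hm', ← hγ.2.1, ← hπ1,
        Measure.map_map measurable_fst measurable_fst]
      rfl
    · rw [Measure.map_map measurable_snd hm', ← hη.2.2, ← hπ2, Measure.map_map measurable_snd hm]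
      rfl
  have e3 := eLpNorm_map_measure (p := p)
    (g := fun z : EuclideanSpace ℝ (Fin d) × EuclideanSpace ℝ (Fin d) => z.1 - z.2)
    (μ := π) (by fun_prop) hm'.aemeasurable
  rw [← hπ1, eLpNorm_map_measure (by fun_prop) measurable_fst.aemeasurable] at h1
  rw [← hπ2, eLpNorm_map_measure (by fun_prop) hm.aemeasurable] at h2
  obtain ⟨hae, hle⟩ := ae_eq_interpolation hp hp' ht ht' hD h1 h2
    ((h3.trans (wassersteinDist_le hζ)).trans_eq e3)
  refine ⟨_, hζ, e3.trans_le hle, ?_, ?_⟩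
  · rw [Measure.map_map (measurable_fst.prodMk hi) hm', ← hπ1]
    refine Measure.map_congr ?_
    filter_upwards [hae] with w hw
    exact Prod.ext rfl hw.symm
  · rw [Measure.map_map (hi.prodMk measurable_snd) hm', ← hπ2]
    refine Measure.map_congr ?_
    filter_upwards [hae] with w hw
    exact Prod.ext hw.symm rfl

theorem WassersteinSpace.exists_isOptimalPlan (μ ν : WassersteinSpace p Ω) :
    ∃ γ, IsOptimalPlan (powCost p) μ.toMeasure ν.toMeasure γ :=
  OptimalTransport.exists_isOptimalPlan (continuous_powCost p) _ _

variable {μ ν : WassersteinSpace p Ω} [Fact (1 ≤ p)] {ω : I → WassersteinSpace p Ω}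

theorem IsConstantSpeedGeodesic.wassersteinDist_eq (hω : IsConstantSpeedGeodesic μ ν ω) {s t : I}
    (hst : s ≤ t) : wassersteinDist p (ω s).toMeasure (ω t).toMeasure =
      ENNReal.ofReal ((t - s : ℝ) * dist μ ν) := by
  have hst' : (s : ℝ) ≤ t := hst
  rw [← WassersteinSpace.edist_eq, edist_dist, hω.2.2, abs_of_nonpos (by linarith), neg_sub]

theorem IsConstantSpeedGeodesic.exists_plan_through (hω : IsConstantSpeedGeodesic μ ν ω)
    (hp : 1 < p) (hp' : p ≠ ∞) {r s t : I} (hrs : r < s) (hst : s < t)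
    {γ η : Measure (EuclideanSpace ℝ (Fin d) × EuclideanSpace ℝ (Fin d))}
    (hγ : IsOptimalPlan (powCost p) (ω r).toMeasure (ω s).toMeasure γ)
    (hη : IsOptimalPlan (powCost p) (ω s).toMeasure (ω t).toMeasure η) :
    ∃ ζ, IsOptimalPlan (powCost p) (ω r).toMeasure (ω t).toMeasure ζ ∧
      ζ.map (fun z => (z.1, interpolation ((s - r) / (t - r) : ℝ) z)) = γ ∧
      ζ.map (fun z => (interpolation ((s - r) / (t - r) : ℝ) z, z.2)) = η := by
  have hrs' : (r : ℝ) < s := hrs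
  have hst' : (s : ℝ) < t := hst
  have h0 : (0 : ℝ) < t - r := by linarith
  rw [isOptimalPlan_iff hp.le hp', hω.wassersteinDist_eq hrs.le] at hγ
  rw [isOptimalPlan_iff hp.le hp', hω.wassersteinDist_eq hst.le] at hη
  have h1 : (0 : ℝ) < (s - r) / (t - r) := div_pos (by linarith) h0
  have h2 : ((s - r) / (t - r) : ℝ) < 1 := (div_lt_one h0).2 (by linarith)
  obtain ⟨ζ, hζ, hle, e⟩ := OptimalTransport.exists_plan_through (D :=
      ENNReal.ofReal ((t - r : ℝ) * dist μ ν)) hp hp' h1 h2 ENNReal.ofReal_ne_top hγ.1 hη.1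
    (hγ.2.trans_eq (by rw [← ENNReal.ofReal_mul h1.le]; congr 1; field_simp))
    (hη.2.trans_eq (by
      rw [← ENNReal.ofReal_mul (by linarith)]; congr 1; field_simp; ring))
    (hω.wassersteinDist_eq (hrs.trans hst).le).ge
  refine ⟨ζ, (isOptimalPlan_iff hp.le hp').2 ⟨hζ, ?_⟩, e⟩
  rwa [hω.wassersteinDist_eq (hrs.trans hst).le]

/-- Geodesics do not branch: the optimal plan between an end point and an interior point of a
geodesic is unique. -/
theorem IsConstantSpeedGeodesic.isOptimalPlan_unique_left (hω : IsConstantSpeedGeodesic μ ν ω)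
    (hp : 1 < p) (hp' : p ≠ ∞) {r s t : I} (hrs : r < s) (hst : s < t)
    {γ γ' : Measure (EuclideanSpace ℝ (Fin d) × EuclideanSpace ℝ (Fin d))}
    (hγ : IsOptimalPlan (powCost p) (ω r).toMeasure (ω s).toMeasure γ)
    (hγ' : IsOptimalPlan (powCost p) (ω r).toMeasure (ω s).toMeasure γ') : γ = γ' := by
  have hrs' : (r : ℝ) < s := hrs
  have hst' : (s : ℝ) < t := hst
  obtain ⟨η, hη⟩ := (ω s).exists_isOptimalPlan (ω t)
  -- With `η` fixed, the starting point is found by extrapolating the segment of `η` backwards past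
  -- time `s`. The resulting formula does not involve `γ`.
  have key : ∀ {γ}, IsOptimalPlan (powCost p) (ω r).toMeasure (ω s).toMeasure γ →
      γ = η.map fun z => (interpolation (-((s - r) / (t - s) : ℝ)) z, z.1) := by
    intro γ hγ
    obtain ⟨ζ, -, rfl, rfl⟩ := hω.exists_plan_through hp hp' hrs hst hγ hη
    rw [Measure.map_map ((measurable_interpolation _).prodMk measurable_fst)
      ((measurable_interpolation _).prodMk measurable_snd)]
    congr 1
    ext z : 1
    refine Prod.ext ?_ rfl
    have h1 : (t - r : ℝ) ≠ 0 := by linarith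
    have h2 : (t - s : ℝ) ≠ 0 := by linarith
    simp only [interpolation, Function.comp_apply]
    match_scalars <;> field_simp <;> ring
  rw [key hγ, ← key hγ']

theorem IsConstantSpeedGeodesic.isOptimalPlan_unique_right (hω : IsConstantSpeedGeodesic μ ν ω)
    (hp : 1 < p) (hp' : p ≠ ∞) {r s t : I} (hrs : r < s) (hst : s < t)
    {η η' : Measure (EuclideanSpace ℝ (Fin d) × EuclideanSpace ℝ (Fin d))}
    (hη : IsOptimalPlan (powCost p) (ω s).toMeasure (ω t).toMeasure η)
    (hη' : IsOptimalPlan (powCost p) (ω s).toMeasure (ω t).toMeasure η') : η = η' := by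
  have hrs' : (r : ℝ) < s := hrs
  have hst' : (s : ℝ) < t := hst
  obtain ⟨γ, hγ⟩ := (ω r).exists_isOptimalPlan (ω s)
  have key : ∀ {η}, IsOptimalPlan (powCost p) (ω s).toMeasure (ω t).toMeasure η →
      η = γ.map fun z => (z.2, interpolation ((t - r) / (s - r) : ℝ) z) := by
    intro η hη
    obtain ⟨ζ, -, rfl, rfl⟩ := hω.exists_plan_through hp hp' hrs hst hγ hη
    rw [Measure.map_map (measurable_snd.prodMk (measurable_interpolation _))
      (measurable_fst.prodMk (measurable_interpolation _))]
    congr 1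
    ext z : 1
    refine Prod.ext rfl ?_
    have h1 : (t - r : ℝ) ≠ 0 := by linarith
    have h2 : (s - r : ℝ) ≠ 0 := by linarith
    simp only [interpolation, Function.comp_apply]
    match_scalars <;> field_simp
    ring
  rw [key hη, ← key hη']

/-- Plans between the two end points need not be unique, but those from `ω 0` to the midpoint and
from the midpoint to `ω 1` are. The plan `ζ` glued from these two therefore controls every
intermediate time on either half. -/
theorem IsConstantSpeedGeodesic.exists_isOptimalPlan_interpolation
    (hω : IsConstantSpeedGeodesic μ ν ω) (hp : 1 < p) (hp' : p ≠ ∞) :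
    ∃ γ, IsOptimalPlan (powCost p) μ.toMeasure ν.toMeasure γ ∧
      ∀ s : I, (ω s).toMeasure = γ.map (interpolation s) := by
  let m : I := ⟨1 / 2, by norm_num, by norm_num⟩
  have hm : (m : ℝ) = 1 / 2 := rfl
  have h0m : (0 : I) < m := Subtype.coe_lt_coe.1 (by rw [hm, Icc.coe_zero]; norm_num)
  have hm1 : m < (1 : I) := Subtype.coe_lt_coe.1 (by rw [hm, Icc.coe_one]; norm_num)
  obtain ⟨γ, hγ⟩ := (ω 0).exists_isOptimalPlan (ω m)
  obtain ⟨η, hη⟩ := (ω m).exists_isOptimalPlan (ω 1)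
  obtain ⟨ζ, hζ, h1, h2⟩ := hω.exists_plan_through hp hp' h0m hm1 hγ hη
  rw [hm, Icc.coe_zero, Icc.coe_one, show ((1 / 2 - 0) / (1 - 0) : ℝ) = 1 / 2 by norm_num] at h1 h2
  refine ⟨ζ, by rwa [← hω.1, ← hω.2.1], fun s => ?_⟩
  rcases lt_trichotomy s m with hs | rfl | hs
  · rcases eq_or_lt_of_le (show 0 ≤ s from s.2.1) with rfl | hs0
    · rw [← hζ.1.2.1]
      congr 1
      ext z : 1
      simp [interpolation]
    · obtain ⟨γ₁, hγ₁⟩ := (ω 0).exists_isOptimalPlan (ω s)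
      obtain ⟨γ₂, hγ₂⟩ := (ω s).exists_isOptimalPlan (ω m)
      -- A plan from `ω 0` to `ω m` passing through `ω s` must, by uniqueness, be `γ`, the first
      -- half of `ζ`; this identifies `ω s`.
      obtain ⟨θ, hθ, e1, -⟩ := hω.exists_plan_through hp hp' hs0 hs hγ₁ hγ₂
      obtain rfl := hω.isOptimalPlan_unique_left hp hp' h0m hm1 hθ hγ
      rw [← hγ₁.1.2.2, ← e1, ← h1, Measure.map_map (by fun_prop)
        (measurable_fst.prodMk (measurable_interpolation _)), Measure.map_map
        ((measurable_snd.comp (measurable_fst.prodMk (measurable_interpolation _))))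
        (measurable_fst.prodMk (measurable_interpolation _))]
      congr 1
      ext z : 1
      simp only [interpolation, Function.comp_apply, hm, Icc.coe_zero]
      module
  · rw [← hγ.1.2.2, ← h1, Measure.map_map (by fun_prop)
        (measurable_fst.prodMk (measurable_interpolation _))]
    rfl
  · rcases eq_or_lt_of_le (show s ≤ 1 from s.2.2) with rfl | hs1
    · rw [← hζ.1.2.2]
      congr 1
      ext z : 1
      simp [interpolation]
    · obtain ⟨γ₁, hγ₁⟩ := (ω m).exists_isOptimalPlan (ω s)
      obtain ⟨γ₂, hγ₂⟩ := (ω s).exists_isOptimalPlan (ω 1)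
      obtain ⟨θ, hθ, e1, -⟩ := hω.exists_plan_through hp hp' hs hs1 hγ₁ hγ₂
      obtain rfl := hω.isOptimalPlan_unique_right hp hp' h0m hm1 hθ hη
      rw [← hγ₁.1.2.2, ← e1, ← h2, Measure.map_map (by fun_prop)
        (measurable_fst.prodMk (measurable_interpolation _)), Measure.map_map
        ((measurable_snd.comp (measurable_fst.prodMk (measurable_interpolation _))))
        ((measurable_interpolation _).prodMk measurable_snd)]
      congr 1
      ext z : 1
      simp only [interpolation, Function.comp_apply, hm, Icc.coe_one]
      module

end Geodesics

/-! ### Pairwise monotonicity of optimal plans. -/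

section Monotonicity

/-- An optimal plan is almost surely monotone for pairs of points: otherwise, exchanging the
targets on the set of bad pairs would lower the cost. -/
theorem IsOptimalPlan.ae_monotone {X : Type*} [MeasurableSpace X] {c : X → X → ℝ≥0∞}
    (hc : Measurable fun z : X × X => c z.1 z.2) {μ ν : Measure X} {γ : Measure (X × X)}
    (hγ : IsOptimalPlan c μ ν γ) (hfin : ∫⁻ z, c z.1 z.2 ∂γ ≠ ∞) :
    ∀ᵐ w ∂γ.prod γ, c w.1.1 w.1.2 + c w.2.1 w.2.2 ≤ c w.1.1 w.2.2 + c w.2.1 w.1.2 := by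
  have := hγ.1.1
  have m1 : Measurable fun w : (X × X) × X × X => (w.1.1, w.2.2) := by fun_prop
  have m2 : Measurable fun w : (X × X) × X × X => (w.2.1, w.1.2) := by fun_prop
  have c1 : Measurable fun w : (X × X) × X × X => c w.1.1 w.1.2 := hc.comp measurable_fst
  have c2 : Measurable fun w : (X × X) × X × X => c w.2.1 w.2.2 := hc.comp measurable_snd
  have c3 : Measurable fun w : (X × X) × X × X => c w.1.1 w.2.2 := hc.comp m1
  have c4 : Measurable fun w : (X × X) × X × X => c w.2.1 w.1.2 := hc.comp m2
  set A : Set ((X × X) × X × X) :=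
    {w | c w.1.1 w.2.2 + c w.2.1 w.1.2 < c w.1.1 w.1.2 + c w.2.1 w.2.2} with hAdef
  have hA : MeasurableSet A := measurableSet_lt (c3.add c4) (c1.add c2)
  set θ := (γ.prod γ).restrict A with hθ
  have half : ∀ {Y : Type _} [MeasurableSpace Y] (α β κ : Measure Y), α ≤ κ → β ≤ κ →
      (2⁻¹ : ℝ≥0∞) • (α + β) ≤ κ := by
    intro Y _ α β κ h1 h2
    refine Measure.le_iff'.2 fun s => ?_
    simp only [Measure.smul_apply, Measure.add_apply, smul_eq_mul]
    calc 2⁻¹ * (α s + β s) ≤ 2⁻¹ * (κ s + κ s) := by gcongr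
      _ = κ s := by rw [← two_mul, ← mul_assoc, ENNReal.inv_mul_cancel (by simp) (by simp), one_mul]
  -- Each projection of `θ` is only bounded by `γ`; the factor one half makes the sum of the two
  -- removable from `γ`.
  have hτ : (2⁻¹ : ℝ≥0∞) • (θ.map Prod.fst + θ.map Prod.snd) ≤ γ := by
    refine half _ _ _ ?_ ?_
    · refine (Measure.map_mono Measure.restrict_le_self measurable_fst).trans_eq ?_
      exact Measure.fst_prod
    · refine (Measure.map_mono Measure.restrict_le_self measurable_snd).trans_eq ?_
      exact Measure.snd_prod
  set τ := (2⁻¹ : ℝ≥0∞) • (θ.map Prod.fst + θ.map Prod.snd) with hτdef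
  set τ' := (2⁻¹ : ℝ≥0∞) • (θ.map (fun w => (w.1.1, w.2.2)) + θ.map (fun w => (w.2.1, w.1.2)))
    with hτ'def
  have : IsFiniteMeasure τ := isFiniteMeasure_of_le γ hτ
  have hsum : γ - τ + τ = γ := Measure.sub_add_cancel_of_le hτ
  have f1 : τ'.map Prod.fst = τ.map Prod.fst := by
    simp only [τ, τ', Measure.map_smul, Measure.map_add _ _ measurable_fst,
      Measure.map_map measurable_fst m1, Measure.map_map measurable_fst m2,
      Measure.map_map measurable_fst measurable_fst, Measure.map_map measurable_fst measurable_snd]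
    rfl
  have f2 : τ'.map Prod.snd = τ.map Prod.snd := by
    simp only [τ, τ', Measure.map_smul, Measure.map_add _ _ measurable_snd,
      Measure.map_map measurable_snd m1, Measure.map_map measurable_snd m2,
      Measure.map_map measurable_snd measurable_fst, Measure.map_map measurable_snd measurable_snd]
    rw [add_comm]
    rfl
  have g1 : (γ - τ + τ').map Prod.fst = μ := by
    rw [Measure.map_add _ _ measurable_fst, f1, ← Measure.map_add _ _ measurable_fst, hsum,
      hγ.1.2.1]
  have g2 : (γ - τ + τ').map Prod.snd = ν := by
    rw [Measure.map_add _ _ measurable_snd, f2, ← Measure.map_add _ _ measurable_snd, hsum,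
      hγ.1.2.2]
  have hprob : IsProbabilityMeasure (γ - τ + τ') := by
    constructor
    have h := congrArg (fun m : Measure X => m univ) (g1.trans hγ.1.2.1.symm)
    simp only [Measure.map_apply measurable_fst MeasurableSet.univ, preimage_univ,
      measure_univ] at h
    exact h
  have hle := hγ.2 _ ⟨hprob, g1, g2⟩
  conv_lhs at hle => rw [← hsum]
  rw [lintegral_add_measure, lintegral_add_measure] at hle
  have hρ : ∫⁻ z, c z.1 z.2 ∂(γ - τ) ≠ ∞ :=
    ne_top_of_le_ne_top hfin (lintegral_mono' Measure.sub_le le_rfl)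
  have hle' := (ENNReal.add_le_add_iff_left hρ).1 hle
  have i1 : ∫⁻ z, c z.1 z.2 ∂τ = 2⁻¹ * ∫⁻ w, (c w.1.1 w.1.2 + c w.2.1 w.2.2) ∂θ := by
    rw [hτdef, lintegral_smul_measure, lintegral_add_measure, lintegral_map hc measurable_fst,
      lintegral_map hc measurable_snd, lintegral_add_left c1, smul_eq_mul]
  have i2 : ∫⁻ z, c z.1 z.2 ∂τ' = 2⁻¹ * ∫⁻ w, (c w.1.1 w.2.2 + c w.2.1 w.1.2) ∂θ := by
    rw [hτ'def, lintegral_smul_measure, lintegral_add_measure, lintegral_map hc m1,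
      lintegral_map hc m2, lintegral_add_left c3, smul_eq_mul]
  have hτfin : ∫⁻ z, c z.1 z.2 ∂τ ≠ ∞ :=
    ne_top_of_le_ne_top hfin (lintegral_mono' hτ le_rfl)
  rw [i1, i2, ENNReal.mul_le_mul_iff_right (by simp) (by simp)] at hle'
  rw [i1] at hτfin
  have hfin' : ∫⁻ w, (c w.1.1 w.1.2 + c w.2.1 w.2.2) ∂θ ≠ ∞ := fun h => hτfin (by rw [h]; simp)
  have hAθ : ∀ᵐ w ∂θ, w ∈ A := ae_restrict_mem hA
  have hAle : (fun w => c w.1.1 w.2.2 + c w.2.1 w.1.2) ≤ᵐ[θ]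
      fun w => c w.1.1 w.1.2 + c w.2.1 w.2.2 := by
    filter_upwards [hAθ] with w hw using le_of_lt hw
  -- Optimality says that the exchange does not lower the cost, while on `A` it strictly does; so
  -- `θ` has no mass.
  have heq := ae_eq_of_ae_le_of_lintegral_le hAle
    (ne_top_of_le_ne_top hfin' (lintegral_mono_ae hAle)) (c1.add c2).aemeasurable hle'
  have hfalse : ∀ᵐ w ∂θ, False := by
    filter_upwards [hAθ, heq] with w hw hw'
    exact absurd hw' (ne_of_lt hw)
  rw [ae_restrict_iff' hA] at hfalse
  filter_upwards [hfalse] with w hw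
  exact not_lt.1 hw

/-- For a continuous cost the bad pairs form an open set, and a product of neighbourhoods of support
points has positive measure, so "almost every" becomes "every". -/
theorem IsOptimalPlan.monotone_support {X : Type*} [MeasurableSpace X] [TopologicalSpace X]
    [SecondCountableTopology X] [BorelSpace X] {c : X → X → ℝ≥0∞}
    (hc : Continuous fun z : X × X => c z.1 z.2) {μ ν : Measure X} {γ : Measure (X × X)}
    (hγ : IsOptimalPlan c μ ν γ) (hfin : ∫⁻ z, c z.1 z.2 ∂γ ≠ ∞) {z z' : X × X}
    (hz : z ∈ γ.support) (hz' : z' ∈ γ.support) :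
    c z.1 z.2 + c z'.1 z'.2 ≤ c z.1 z'.2 + c z'.1 z.2 := by
  have := hγ.1.1
  have hae := hγ.ae_monotone hc.measurable hfin
  by_contra hlt
  have hopen : IsOpen {w : (X × X) × X × X |
      c w.1.1 w.2.2 + c w.2.1 w.1.2 < c w.1.1 w.1.2 + c w.2.1 w.2.2} := by
    refine isOpen_lt (Continuous.add ?_ ?_) (Continuous.add ?_ ?_)
    · exact hc.comp (f := fun w : (X × X) × X × X => (w.1.1, w.2.2)) (by fun_prop)
    · exact hc.comp (f := fun w : (X × X) × X × X => (w.2.1, w.1.2)) (by fun_prop)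
    · exact hc.comp continuous_fst
    · exact hc.comp continuous_snd
  obtain ⟨U, hU, V, hV, hUV⟩ := mem_nhds_prod_iff.1
    (hopen.mem_nhds (show (z, z') ∈ _ from not_le.1 hlt))
  have h0 : (γ.prod γ) (U ×ˢ V) = 0 :=
    measure_mono_null (fun w hw => not_le.2 (hUV hw)) (ae_iff.1 hae)
  rw [Measure.prod_prod, mul_eq_zero] at h0
  rcases h0 with h | h
  · exact ((Measure.mem_support_iff_forall z).1 hz U hU).ne' h
  · exact ((Measure.mem_support_iff_forall z').1 hz' V hV).ne' h

end Monotonicity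

/-! ### Monotone sets are single-valued almost everywhere. -/

section Density

open scoped Pointwise

variable {E : Type*} [NormedAddCommGroup E] [NormedSpace ℝ E]

theorem StrictConvexOn.fderiv_sub_pos {h : E → ℝ} {h' : E → E →L[ℝ] ℝ}
    (hconv : StrictConvexOn ℝ univ h) (hh : ∀ x, HasFDerivAt h (h' x) x) {a b : E} (hab : a ≠ b) :
    0 < (h' a - h' b) (a - b) := by
  let g : ℝ → ℝ := fun t => h (b + t • (a - b))
  have hg : ∀ t, HasDerivAt g (h' (b + t • (a - b)) (a - b)) t := fun t => by
    have h1 : HasDerivAt (fun t : ℝ => b + t • (a - b)) (a - b) t := by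
      simpa using ((hasDerivAt_id t).smul_const (a - b)).const_add b
    exact (hh _).comp_hasDerivAt t h1
  have hgc : StrictConvexOn ℝ univ g := by
    refine ⟨convex_univ, fun s _ t _ hst α β hα hβ hαβ => ?_⟩
    have hne : b + s • (a - b) ≠ b + t • (a - b) := fun e =>
      hst (smul_left_injective ℝ (sub_ne_zero.2 hab) (add_left_cancel e))
    have := hconv.2 (mem_univ _) (mem_univ _) hne hα hβ hαβ
    refine lt_of_eq_of_lt (congrArg h ?_) this
    have hβ' : β = 1 - α := by linarith
    subst hβ'
    simp only [smul_eq_mul]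
    module
  have h01 := hgc.strictMonoOn_deriv (fun t _ => (hg t).differentiableAt) (mem_univ 0) (mem_univ 1)
    one_pos
  rw [(hg 0).deriv, (hg 1).deriv] at h01
  simpa [sub_pos] using h01

variable [FiniteDimensional ℝ E] [MeasurableSpace E] [BorelSpace E] (m : Measure E)
  [m.IsAddHaarMeasure]

/-- If `y₀ ≠ y₁`, strict monotonicity of the derivative makes `L v` positive. Density yields points
`x = x₀ + r • w` with `w` in a cone around `v` and a partner `y` near `y₀`. To first order,
monotonicity of `(x, y)` against `(x₀, y₁)` reads `L w ≤ 2 * δ * ‖w‖`, which fails in that cone. -/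
theorem eq_of_monotone_of_density {h : E → ℝ} {h' : E → E →L[ℝ] ℝ}
    (hconv : StrictConvexOn ℝ univ h) (hh : ∀ x, HasStrictFDerivAt h (h' x) x) {Γ : Set (E × E)}
    (hΓ : ∀ z ∈ Γ, ∀ z' ∈ Γ, h (z.1 - z.2) + h (z'.1 - z'.2) ≤ h (z.1 - z'.2) + h (z'.1 - z.2))
    {x₀ y₀ y₁ : E} (h1 : (x₀, y₁) ∈ Γ)
    (hdens : ∀ V ∈ 𝓝 y₀, ∃ S ⊆ {x | ∃ y ∈ V, (x, y) ∈ Γ},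
      Tendsto (fun r => m (S ∩ Metric.closedBall x₀ r) / m (Metric.closedBall x₀ r))
        (𝓝[>] 0) (𝓝 1)) : y₀ = y₁ := by
  by_contra hne
  set v := y₁ - y₀ with hv
  set L := h' (x₀ - y₀) - h' (x₀ - y₁) with hL
  have hpos : 0 < L v := by
    have := StrictConvexOn.fderiv_sub_pos hconv (fun x => (hh x).hasFDerivAt)
      (a := x₀ - y₀) (b := x₀ - y₁) (fun e => hne (sub_right_injective e))
    rwa [show x₀ - y₀ - (x₀ - y₁) = v by rw [hv]; abel] at this
  -- The `+ 1` makes `2 * δ * ‖v‖ < L v` strict, so `v` lies in the open cone.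
  set δ := L v / (2 * (‖v‖ + 1)) with hδ
  have hδ0 : 0 < δ := by positivity
  have hδv : 2 * δ * ‖v‖ < L v := by
    have : 2 * δ * (‖v‖ + 1) = L v := by rw [hδ]; field_simp
    nlinarith
  -- Strict differentiability is what makes this expansion uniform in the partner `w.2` near `y₀`.
  have e0 : ∀ᶠ w : E × E in 𝓝 (x₀, y₀), ‖h (w.1 - w.2) - h (x₀ - w.2) -
      h' (x₀ - y₀) (w.1 - x₀)‖ ≤ δ * ‖w.1 - x₀‖ := by
    have ht : Tendsto (fun w : E × E => (w.1 - w.2, x₀ - w.2)) (𝓝 (x₀, y₀))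
        (𝓝 (x₀ - y₀, x₀ - y₀)) :=
      Continuous.tendsto' (by fun_prop) _ _ rfl
    filter_upwards [ht.eventually ((hh (x₀ - y₀)).isLittleO.def hδ0)] with w hw
    simpa using hw
  have e1 : ∀ᶠ x in 𝓝 x₀, ‖h (x - y₁) - h (x₀ - y₁) - h' (x₀ - y₁) (x - x₀)‖ ≤
      δ * ‖x - x₀‖ := by
    have ht : Tendsto (fun x : E => (x - y₁, x₀ - y₁)) (𝓝 x₀) (𝓝 (x₀ - y₁, x₀ - y₁)) :=
      Continuous.tendsto' (by fun_prop) _ _ rfl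
    filter_upwards [ht.eventually ((hh (x₀ - y₁)).isLittleO.def hδ0)] with w hw
    simpa using hw
  obtain ⟨U, hU, V, hV, hUV⟩ := mem_nhds_prod_iff.1 e0
  obtain ⟨S, hS, hdS⟩ := hdens V hV
  -- Open and nonempty, hence of positive measure, so a set of density one meets its small copies;
  -- bounded, so these copies shrink to `x₀`.
  set t : Set E := {w | 2 * δ * ‖w‖ < L w} ∩ Metric.ball 0 (‖v‖ + 1) with ht
  have htopen : IsOpen t :=
    (isOpen_lt (by fun_prop) L.continuous).inter Metric.isOpen_ball
  have htne : t.Nonempty := ⟨v, hδv, by simp⟩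
  have hnonempty := Measure.eventually_nonempty_inter_smul_of_density_one m S x₀ hdS t
    htopen.measurableSet (htopen.measure_pos m htne).ne'
  have hsub : ∀ᶠ r in 𝓝[>] (0 : ℝ),
      {x₀} + r • t ⊆ U ∩ {x | ‖h (x - y₁) - h (x₀ - y₁) - h' (x₀ - y₁) (x - x₀)‖ ≤
        δ * ‖x - x₀‖} :=
    nhdsWithin_le_nhds (eventually_singleton_add_smul_subset
      (Metric.isBounded_ball.subset inter_subset_right) (inter_mem hU e1))
  obtain ⟨r, ⟨x, hxS, hx⟩, hr, hr0⟩ := (hnonempty.and (hsub.and self_mem_nhdsWithin)).exists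
  have hr0' : 0 < r := hr0
  obtain ⟨hxU, hx1⟩ := hr hx
  obtain ⟨y, hyV, hxy⟩ := hS hxS
  have hx0 := hUV (show (x, y) ∈ U ×ˢ V from ⟨hxU, hyV⟩)
  rw [singleton_add] at hx
  obtain ⟨_, ⟨w, hw, rfl⟩, rfl⟩ := hx
  have hmono := hΓ _ hxy _ h1
  simp only [mem_ofPred_eq, add_sub_cancel_left, Real.norm_eq_abs, abs_le, norm_smul,
    map_smul, smul_eq_mul, abs_of_pos hr0'] at hx0 hx1 hmono
  have hw' : 2 * δ * ‖w‖ < h' (x₀ - y₀) w - h' (x₀ - y₁) w := hw.1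
  have := mul_lt_mul_of_pos_left hw' hr0'
  nlinarith [hx0.1, hx1.2]

/-- Almost every point is a density point of each slice that contains it, where the slices are
indexed by a countable basis of target sets. The slices are projections and may fail to be
measurable; the density theorem used holds for arbitrary sets. -/
theorem ae_subsingleton_of_monotone {h : E → ℝ} {h' : E → E →L[ℝ] ℝ}
    (hconv : StrictConvexOn ℝ univ h) (hh : ∀ x, HasStrictFDerivAt h (h' x) x) {Γ : Set (E × E)}
    (hΓ : ∀ z ∈ Γ, ∀ z' ∈ Γ, h (z.1 - z.2) + h (z'.1 - z'.2) ≤ h (z.1 - z'.2) + h (z'.1 - z.2)) :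
    ∀ᵐ x ∂m, ∀ y y', (x, y) ∈ Γ → (x, y') ∈ Γ → y = y' := by
  have hB := TopologicalSpace.isBasis_countableBasis E
  have : Countable (TopologicalSpace.countableBasis E) :=
    (TopologicalSpace.countable_countableBasis E).to_subtype
  have hae : ∀ᵐ x ∂m, ∀ V : TopologicalSpace.countableBasis E,
      x ∈ {x | ∃ y ∈ (V : Set E), (x, y) ∈ Γ} →
      Tendsto (fun r => m ({x | ∃ y ∈ (V : Set E), (x, y) ∈ Γ} ∩ Metric.closedBall x r) /
        m (Metric.closedBall x r)) (𝓝[>] 0) (𝓝 1) :=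
    ae_all_iff.2 fun V => ae_imp_of_ae_restrict (Besicovitch.ae_tendsto_measure_inter_div m _)
  filter_upwards [hae] with x hx y y' hy hy'
  refine eq_of_monotone_of_density m hconv hh hΓ hy' fun V hV => ?_
  obtain ⟨W, hW, hyW, hWV⟩ := hB.mem_nhds_iff.1 hV
  refine ⟨{x | ∃ y ∈ W, (x, y) ∈ Γ}, ?_, hx ⟨W, hW⟩ ⟨y, hyW, hy⟩⟩
  rintro x' ⟨z, hz, hz'⟩
  exact ⟨z, hWV hz, hz'⟩

end Density

/-! ### From single-valuedness to a measurable map. -/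

section Graph

variable {E : Type*} [NormedAddCommGroup E] [NormedSpace ℝ E] [CompleteSpace E]
  [SecondCountableTopology E] [MeasurableSpace E] [BorelSpace E]

/-- Almost every conditional measure is a Dirac mass. Taking its barycentre as `T` gives
measurability with no selection argument. -/
theorem exists_ae_eq_graph {μ ν : Measure E} {γ : Measure (E × E)} (hγ : γ ∈ transportPlans μ ν)
    {Γ : Set (E × E)} (hΓ : ∀ᵐ z ∂γ, z ∈ Γ)
    (hμ : ∀ᵐ x ∂μ, ∀ y y', (x, y) ∈ Γ → (x, y') ∈ Γ → y = y') :
    ∃ T : E → E, Measurable T ∧ ∀ᵐ z ∂γ, z.2 = T z.1 := by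
  have := hγ.1
  have hdis : γ = μ.compProd γ.condKernel := by
    rw [← hγ.2.1]; exact (γ.disintegrate γ.condKernel).symm
  have : IsProbabilityMeasure μ := by
    rw [← hγ.2.1]; exact Measure.isProbabilityMeasure_map measurable_fst.aemeasurable
  have hT : Measurable fun x => ∫ y, y ∂(γ.condKernel x) :=
    (StronglyMeasurable.integral_kernel (f := fun y : E => y)
      stronglyMeasurable_id).measurable
  refine ⟨_, hT, ?_⟩
  rw [hdis] at hΓ
  conv in ae _ => rw [hdis]
  refine Measure.ae_compProd_of_ae_ae
    (measurableSet_eq_fun measurable_snd (hT.comp measurable_fst)) ?_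
  filter_upwards [Measure.ae_ae_of_ae_compProd hΓ, hμ] with x hx hx'
  obtain ⟨y₀, hy₀⟩ := hx.exists
  have hc : ∀ᵐ y ∂(γ.condKernel x), y = y₀ := by
    filter_upwards [hx] with y hy using hx' _ _ hy hy₀
  have : ∫ y, y ∂(γ.condKernel x) = y₀ := by
    rw [integral_congr_ae hc]; simp
  filter_upwards [hc] with y hy
  simp only [hy, this]

end Graph

/-! ### Existence and uniqueness of optimal maps. -/

section OptimalMaps

variable {d : ℕ} {p : ℝ≥0∞} {Ω : Set (EuclideanSpace ℝ (Fin d))}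
  {μ ν : Measure (EuclideanSpace ℝ (Fin d))}

theorem powCost_eq_ofReal (p : ℝ≥0∞) (x y : EuclideanSpace ℝ (Fin d)) :
    powCost p x y = ENNReal.ofReal (‖x - y‖ ^ p.toReal) := by
  rw [powCost, ← ofReal_norm, ENNReal.ofReal_rpow_of_nonneg (norm_nonneg _) ENNReal.toReal_nonneg]

theorem IsOptimalPlan.exists_ae_eq_graph (hp : 1 < p) (hp' : p ≠ ∞) (hμ : μ ≪ volume)
    {γ : Measure (EuclideanSpace ℝ (Fin d) × EuclideanSpace ℝ (Fin d))}
    (hγ : IsOptimalPlan (powCost p) μ ν γ) (hfin : ∫⁻ z, powCost p z.1 z.2 ∂γ ≠ ∞) :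
    ∃ T : EuclideanSpace ℝ (Fin d) → EuclideanSpace ℝ (Fin d),
      Measurable T ∧ ∀ᵐ z ∂γ, z.2 = T z.1 := by
  have hq : 1 < p.toReal := by
    rwa [← ENNReal.toReal_one, ENNReal.toReal_lt_toReal ENNReal.one_ne_top hp']
  -- Since the exponent exceeds one, `‖x‖ ^ p` is continuously differentiable at the origin as well.
  have hstrict : ∀ x : EuclideanSpace ℝ (Fin d), HasStrictFDerivAt
      (fun x => ‖x‖ ^ p.toReal) (fderiv ℝ (fun x => ‖x‖ ^ p.toReal) x) x := fun x =>
    (contDiff_norm_rpow hq).contDiffAt.hasStrictFDerivAt one_ne_zero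
  refine OptimalTransport.exists_ae_eq_graph hγ.1 (Γ := γ.support) Measure.support_mem_ae
    (hμ.ae_le (ae_subsingleton_of_monotone volume (strictConvexOn_norm_rpow hq) hstrict
      fun z hz z' hz' => ?_))
  have h := hγ.monotone_support (continuous_powCost p) hfin hz hz'
  simp only [powCost_eq_ofReal] at h
  rwa [← ENNReal.ofReal_add (by positivity) (by positivity),
    ← ENNReal.ofReal_add (by positivity) (by positivity),
    ENNReal.ofReal_le_ofReal_iff (by positivity)] at h

/-- Used for uniqueness: the average of two optimal plans is again carried by one graph, which must
then carry both. -/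
theorem IsOptimalPlan.average {X : Type*} [MeasurableSpace X] {c : X → X → ℝ≥0∞}
    {μ ν : Measure X} {γ γ' : Measure (X × X)} (hγ : IsOptimalPlan c μ ν γ)
    (hγ' : IsOptimalPlan c μ ν γ') : IsOptimalPlan c μ ν ((2⁻¹ : ℝ≥0∞) • (γ + γ')) := by
  have := hγ.1.1
  have := hγ'.1.1
  have half : ∀ a : ℝ≥0∞, 2⁻¹ * (a + a) = a := fun a => by
    rw [← two_mul, ← mul_assoc, ENNReal.inv_mul_cancel (by simp) (by simp), one_mul]
  have halfm : ∀ m : Measure X, (2⁻¹ : ℝ≥0∞) • (m + m) = m := fun m =>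
    Measure.ext fun s _ => half (m s)
  refine ⟨⟨⟨?_⟩, ?_, ?_⟩, fun η hη => ?_⟩
  · simpa [← two_mul, mul_comm] using half 1
  · rw [Measure.map_smul, Measure.map_add _ _ measurable_fst, hγ.1.2.1, hγ'.1.2.1, halfm]
  · rw [Measure.map_smul, Measure.map_add _ _ measurable_snd, hγ.1.2.2, hγ'.1.2.2, halfm]
  · rw [lintegral_smul_measure, lintegral_add_measure, smul_eq_mul]
    calc _ ≤ 2⁻¹ * (∫⁻ z, c z.1 z.2 ∂η + ∫⁻ z, c z.1 z.2 ∂η) :=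
          mul_le_mul_right (add_le_add (hγ.2 η hη) (hγ'.2 η hη)) _
      _ = _ := half _

theorem map_prodMk_eq_of_ae_eq {X : Type*} [MeasurableSpace X] {μ ν : Measure X}
    {γ : Measure (X × X)} (hγ : γ ∈ transportPlans μ ν) {T : X → X} (hT : Measurable T)
    (h : ∀ᵐ z ∂γ, z.2 = T z.1) : μ.map (fun x => (x, T x)) = γ := by
  rw [← hγ.2.1, Measure.map_map (measurable_id'.prodMk hT) measurable_fst]
  conv_rhs => rw [← Measure.map_id (μ := γ)]
  refine Measure.map_congr ?_
  filter_upwards [h] with z hz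
  exact Prod.ext rfl hz.symm

variable {μ ν : WassersteinSpace p Ω}

/-- For `1 < p < ∞` and an absolutely continuous source, there is exactly one optimal plan, and it
is induced by a map. -/
theorem WassersteinSpace.exists_optimalMap (hΩm : MeasurableSet Ω) (hp : 1 < p) (hp' : p ≠ ∞)
    (hμ : μ.toMeasure ≪ volume) :
    ∃ T : EuclideanSpace ℝ (Fin d) → EuclideanSpace ℝ (Fin d), MapsTo T Ω Ω ∧
      IsOptimalMap (powCost p) μ.toMeasure ν.toMeasure T ∧
      ∀ γ, IsOptimalPlan (powCost p) μ.toMeasure ν.toMeasure γ →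
        μ.toMeasure.map (fun x => (x, T x)) = γ := by
  have hfin : ∀ {γ}, IsOptimalPlan (powCost p) μ.toMeasure ν.toMeasure γ →
      ∫⁻ z, powCost p z.1 z.2 ∂γ ≠ ∞ := fun hγ => by
    rw [lintegral_powCost hp.le hp']
    exact ENNReal.rpow_ne_top_of_nonneg ENNReal.toReal_nonneg
      (eLpNorm_ne_top_of_mem_transportPlans hγ.1)
  obtain ⟨γ, hγ⟩ := μ.exists_isOptimalPlan ν
  obtain ⟨S, hS, hγS⟩ := hγ.exists_ae_eq_graph hp hp' hμ (hfin hγ)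
  have hSΩ : ∀ᵐ x ∂μ.toMeasure, S x ∈ Ω := by
    rw [← hγ.1.2.1, ae_map_iff measurable_fst.aemeasurable (hS hΩm)]
    filter_upwards [hγS, ae_snd_mem_of_mem_transportPlans hγ.1 ν.concentrated] with z h1 h2
    rwa [← h1]
  classical
  -- Redefining `S` on a null set makes the map send `Ω` into itself everywhere.
  let T : EuclideanSpace ℝ (Fin d) → EuclideanSpace ℝ (Fin d) :=
    fun x => if S x ∈ Ω then S x else x
  have hT : Measurable T := Measurable.ite (hS hΩm) hS measurable_id
  have hTS : ∀ᵐ x ∂μ.toMeasure, T x = S x := by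
    filter_upwards [hSΩ] with x hx using if_pos hx
  have key : ∀ γ', IsOptimalPlan (powCost p) μ.toMeasure ν.toMeasure γ' →
      μ.toMeasure.map (fun x => (x, T x)) = γ' := by
    intro γ' hγ'
    have havg := hγ.average hγ'
    obtain ⟨R, hR, hγR⟩ := havg.exists_ae_eq_graph hp hp' hμ (hfin havg)
    replace hγR := ae_add_measure_iff.1
      ((Measure.absolutelyContinuous_smul (c := (2⁻¹ : ℝ≥0∞)) (by simp)).ae_le hγR)
    have hRS : ∀ᵐ x ∂μ.toMeasure, R x = S x := by
      rw [← hγ.1.2.1, ae_map_iff measurable_fst.aemeasurable (measurableSet_eq_fun hR hS)]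
      filter_upwards [hγS, hγR.1] with z h1 h2
      rw [← h1, ← h2]
    refine map_prodMk_eq_of_ae_eq hγ'.1 hT ?_
    have hRT : ∀ᵐ z ∂γ', R z.1 = T z.1 := by
      refine ae_of_ae_map measurable_fst.aemeasurable (p := fun x => R x = T x) ?_
      rw [hγ'.1.2.1]
      filter_upwards [hRS, hTS] with x h1 h2
      rw [h1, h2]
    filter_upwards [hγR.2, hRT] with z h1 h2
    rw [h1, h2]
  refine ⟨T, fun x hx => ?_, ⟨hT, by rwa [key γ hγ]⟩, key⟩
  by_cases h : S x ∈ Ω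
  · simpa only [T, if_pos h] using h
  · simpa only [T, if_neg h] using hx

theorem ae_eq_of_map_prodMk_eq {X : Type*} [MeasurableSpace X] [MeasurableEq X] {μ : Measure X}
    {S T : X → X} (hS : Measurable S) (hT : Measurable T)
    (h : μ.map (fun x => (x, S x)) = μ.map (fun x => (x, T x))) : S =ᵐ[μ] T := by
  have hm : MeasurableSet {z : X × X | z.2 = T z.1} :=
    measurableSet_eq_fun measurable_snd (hT.comp measurable_fst)
  have h1 : ∀ᵐ z ∂(μ.map fun x => (x, T x)), z.2 = T z.1 := by
    rw [ae_map_iff (measurable_id'.prodMk hT).aemeasurable hm]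
    exact ae_of_all _ fun _ => rfl
  rw [← h, ae_map_iff (measurable_id'.prodMk hS).aemeasurable hm] at h1
  exact h1

end OptimalMaps

end OptimalTransport

end

/-! ### The main theorem. -/

theorem mainTheorem6 {d : ℕ} (Ω : Set (EuclideanSpace ℝ (Fin d))) (hΩ : Convex ℝ Ω)
    (hΩm : MeasurableSet Ω) (p : ℝ≥0∞) [Fact (1 ≤ p)] :
    IsLengthSpace (WassersteinSpace p Ω) ∧
    (p ≠ ∞ → ∀ μ ν : WassersteinSpace p Ω,
      (∃ γ, IsOptimalPlan (powCost p)
        μ.toMeasure ν.toMeasure γ) ∧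
      (∀ γ, IsOptimalPlan (powCost p)
          μ.toMeasure ν.toMeasure γ →
        ∃ ω : I → WassersteinSpace p Ω,
          (∀ s : I, (ω s).toMeasure = γ.map (interpolation s)) ∧
          IsConstantSpeedGeodesic μ ν ω) ∧
      (1 < p →
        (∀ ω : I → WassersteinSpace p Ω,
          IsConstantSpeedGeodesic μ ν ω →
          ∃ γ, IsOptimalPlan (powCost p)
              μ.toMeasure ν.toMeasure γ ∧
            ∀ s : I, (ω s).toMeasure = γ.map (interpolation s)) ∧
        (μ.toMeasure ≪ volume →
          ∃ T : EuclideanSpace ℝ (Fin d) → EuclideanSpace ℝ (Fin d),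
            (MapsTo T Ω Ω ∧
              IsOptimalMap (powCost p)
                μ.toMeasure ν.toMeasure T ∧
              ∀ T', IsOptimalMap (powCost p)
                μ.toMeasure ν.toMeasure T' → T' =ᵐ[μ.toMeasure] T) ∧
            ∃ ω : I → WassersteinSpace p Ω,
              IsConstantSpeedGeodesic μ ν ω ∧
              (∀ ω' : I → WassersteinSpace p Ω,
                IsConstantSpeedGeodesic μ ν ω' → ω' = ω) ∧
              ∀ s : I, (ω s).toMeasure =
                μ.toMeasure.map fun x => (1 - (s : ℝ)) • x + (s : ℝ) • T x))) := by
  refine ⟨isLengthSpace_wassersteinSpace hΩ hΩm, fun hp' μ ν => ⟨μ.exists_isOptimalPlan ν,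
    fun γ hγ => ⟨interpolationCurve hΩ hΩm hγ.1, fun s => rfl,
      isConstantSpeedGeodesic_interpolationCurve hΩ hΩm hp' hγ⟩,
    fun hp => ⟨fun ω hω => hω.exists_isOptimalPlan_interpolation hp hp', fun hμ => ?_⟩⟩⟩
  obtain ⟨T, hTΩ, hT, huniq⟩ := WassersteinSpace.exists_optimalMap (ν := ν) hΩm hp hp' hμ
  refine ⟨T, ⟨hTΩ, hT, fun T' hT' => (ae_eq_of_map_prodMk_eq hT.1 hT'.1 (huniq _ hT'.2)).symm⟩,
    interpolationCurve hΩ hΩm hT.2.1,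
    isConstantSpeedGeodesic_interpolationCurve hΩ hΩm hp' hT.2, fun ω' hω' => ?_, fun s => ?_⟩
  -- Any geodesic is generated by some optimal plan, and the only one is the plan induced by `T`.
  · obtain ⟨γ, hγ, hγω⟩ := hω'.exists_isOptimalPlan_interpolation hp hp'
    funext s
    refine WassersteinSpace.ext ((hγω s).trans ?_)
    rw [← huniq γ hγ]
    rfl
  · refine (Measure.map_map (measurable_interpolation _) (measurable_id'.prodMk hT.1)).trans ?_
    congr 1
    ext x : 1
    simp only [interpolation, Function.comp_apply]
    module
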